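/- Let $G=(V,E)$ be a finite simple graph that has no induced subgraph isomorphic to the claw $K_{1,3}$, to the paw (a triangle together with a fourth vertex adjacent to exactly one vertex of the triangle), or to the co-paw (the complement of the paw, i.e. the disjoint union of a path on three vertices and a single vertex). Let $$X_G=\sum_{\kappa}\ \prod_{v\in V}x_{\kappa(v)}$$ be the chromatic symmetric function of $G$, where the sum is over all maps $\kappa:V\to\{1,2,3,\dots\}$ with $\kappa(u)\neq\kappa(v)$ whenever $u$ and $v$ are adjacent. Then $X_G$ is $e$-positive: it is a finite linear combination, with nonnegative integer coefficients, of the functions $e_\lambda=e_{\lambda_1}e_{\lambda_2}\cdots e_{\lambda_\ell}$, where $\lambda=(\lambda_1,\dots,\lambda_\ell)$ ranges over integer partitions (including the empty one, with $e_\emptyset=1$) and $e_k=\sum_{j_1<\cdots<j_k}x_{j_1}\cdots x_{j_k}$. -/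

import Mathlib

/-- In the ring of formal power series over `ℤ` in countably many variables `x₁, x₂, …`: the formal
sum `∑ᵢ x ^ (m i)` of a (possibly infinite) family of monomials, given by their exponents. The
coefficient of a monomial is the number of times that it occurs in the family; this is meaningful
when every monomial occurs finitely often (see `hasSum_monomialSum`). -/
noncomputable def monomialSum {ι : Type*} (m : ι → ℕ+ →₀ ℕ) : MvPowerSeries ℕ+ ℤ :=
  fun d => (Nat.card {i : ι // m i = d} : ℤ)

open scoped MvPowerSeries.WithPiTopology in
/-- `monomialSum m` is the sum of the monomials `x ^ (m i)` in the usual topology on formal power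
series (coefficientwise convergence, `ℤ` discrete). -/
theorem hasSum_monomialSum {ι : Type*} (m : ι → ℕ+ →₀ ℕ)
    (hm : ∀ d, Finite {i : ι // m i = d}) :
    HasSum (fun i => MvPowerSeries.monomial (m i) (1 : ℤ)) (monomialSum m) := by
  classical
  rw [MvPowerSeries.WithPiTopology.hasSum_iff_hasSum_coeff]
  intro d
  have hfin : {i : ι | m i = d}.Finite := hm d
  have h : HasSum (fun i => MvPowerSeries.coeff d (MvPowerSeries.monomial (m i) (1 : ℤ)))
      (∑ i ∈ hfin.toFinset, MvPowerSeries.coeff d (MvPowerSeries.monomial (m i) (1 : ℤ))) := by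
    apply hasSum_sum_of_ne_finset_zero
    intro i hi
    rw [MvPowerSeries.coeff_monomial, if_neg]
    simpa [eq_comm] using hi
  suffices e : MvPowerSeries.coeff d (monomialSum m) =
      ∑ i ∈ hfin.toFinset, MvPowerSeries.coeff d (MvPowerSeries.monomial (m i) (1 : ℤ)) by
    rw [e]
    exact h
  rw [Finset.sum_congr rfl (g := fun _ => (1 : ℤ))]
  · simp only [Finset.sum_const, nsmul_eq_mul, mul_one]
    change ((Nat.card {i : ι | m i = d} : ℕ) : ℤ) = _
    rw [Nat.card_eq_card_finite_toFinset hfin]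
  · intro i hi
    rw [MvPowerSeries.coeff_monomial, if_pos]
    simpa [eq_comm] using hi

/-- The chromatic symmetric function `X_G = ∑_κ ∏_v x_{κ(v)}` of a finite graph, the sum being over
all proper colorings `κ` of the vertices by positive integers. -/
noncomputable def chromaticSymmetricFunction {V : Type*} [Fintype V] (G : SimpleGraph V) :
    MvPowerSeries ℕ+ ℤ :=
  monomialSum fun κ : G.Coloring ℕ+ => ∑ v, Finsupp.single (κ v) 1

/-- Only finitely many proper colorings contribute to a given monomial. -/
theorem finite_coloring_fiber {V : Type*} [Fintype V] (G : SimpleGraph V) (d : ℕ+ →₀ ℕ) :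
    Finite {κ : G.Coloring ℕ+ // ∑ v, Finsupp.single (κ v) 1 = d} := by
  classical
  refine Finite.of_injective
    (β := V → d.support) (fun κ v => ⟨κ.1 v, ?_⟩) ?_
  · rw [Finsupp.mem_support_iff]
    intro h
    have h' := DFunLike.congr_fun κ.2 (κ.1 v)
    rw [h, Finsupp.finsetSum_apply] at h'
    have := Finset.sum_eq_zero_iff.mp h' v (Finset.mem_univ v)
    simp at this
  · intro κ κ' h
    apply Subtype.ext
    apply RelHom.ext
    intro v
    exact congrArg Subtype.val (congrFun h v)

open scoped MvPowerSeries.WithPiTopology in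
theorem hasSum_chromaticSymmetricFunction {V : Type*} [Fintype V] (G : SimpleGraph V) :
    HasSum (fun κ : G.Coloring ℕ+ => ∏ v, (MvPowerSeries.X (κ v) : MvPowerSeries ℕ+ ℤ))
      (chromaticSymmetricFunction G) := by
  convert hasSum_monomialSum _ (finite_coloring_fiber G) using 2 with κ
  · simp only [MvPowerSeries.X]
    rw [MvPowerSeries.prod_monomial, Finset.prod_const_one]
  · rfl

/-- The elementary symmetric function `e_k = ∑_{j₁ < ⋯ < j_k} x_{j₁} ⋯ x_{j_k}`, the sum being over
all `k`-element sets of indices. -/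
noncomputable def elementarySymm (k : ℕ) : MvPowerSeries ℕ+ ℤ :=
  monomialSum fun s : {s : Finset ℕ+ // s.card = k} => ∑ j ∈ s.1, Finsupp.single j 1

/-- A set of indices is determined by its monomial. -/
theorem finite_finset_fiber (k : ℕ) (d : ℕ+ →₀ ℕ) :
    Finite {s : {s : Finset ℕ+ // s.card = k} // ∑ j ∈ s.1, Finsupp.single j 1 = d} := by
  classical
  refine Finite.of_injective (β := Unit) (fun _ => ()) ?_
  have key : ∀ s : Finset ℕ+, (∑ j ∈ s, Finsupp.single j 1 : ℕ+ →₀ ℕ).support = s := by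
    intro s
    ext j
    simp [Finsupp.finsetSum_apply, Finsupp.single_apply]
  intro s t _
  apply Subtype.ext
  apply Subtype.ext
  rw [← key s.1.1, ← key t.1.1, s.2, t.2]

open scoped MvPowerSeries.WithPiTopology in
theorem hasSum_elementarySymm (k : ℕ) :
    HasSum (fun s : {s : Finset ℕ+ // s.card = k} =>
      ∏ j ∈ s.1, (MvPowerSeries.X j : MvPowerSeries ℕ+ ℤ)) (elementarySymm k) := by
  convert hasSum_monomialSum _ (finite_finset_fiber k) using 2 with s
  · simp only [MvPowerSeries.X]
    rw [MvPowerSeries.prod_monomial, Finset.prod_const_one]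
  · rfl

/-- `e_λ = e_{λ₁} e_{λ₂} ⋯ e_{λ_ℓ}` for a partition `λ` of `n` (so `e_∅ = 1` if `n = 0`). -/
noncomputable def elementarySymmPart {n : ℕ} (p : n.Partition) : MvPowerSeries ℕ+ ℤ :=
  (p.parts.map elementarySymm).prod

/-- `f` is e-positive: it is a (finite) linear combination, with nonnegative coefficients, of the
elementary symmetric functions `e_λ`, where `λ` runs over the partitions of all integers. -/
def IsEPositive (f : MvPowerSeries ℕ+ ℤ) : Prop :=
  ∃ c : (Σ n : ℕ, n.Partition) →₀ ℤ, (∀ p, 0 ≤ c p) ∧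
    f = c.sum fun p a => a • elementarySymmPart p.2

/-- `G` is `H`-free: `G` has no induced subgraph isomorphic to `H`. -/
def IsInducedFree {V W : Type*} (H : SimpleGraph W) (G : SimpleGraph V) : Prop :=
  ¬ H.IsIndContained G

/-- The claw `K_{1,3}`. -/
def clawGraph : SimpleGraph (Fin 1 ⊕ Fin 3) := completeBipartiteGraph (Fin 1) (Fin 3)

/-- The paw: a triangle `1, 2, 3` with a pendant vertex `0` attached to `1`. -/
def pawGraph : SimpleGraph (Fin 4) :=
  SimpleGraph.fromEdgeSet {s(0, 1), s(1, 2), s(1, 3), s(2, 3)}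

/-- The co-paw: the complement of the paw. -/
def copawGraph : SimpleGraph (Fin 4) := pawGraphᶜ

-- If adjacency is transitive on distinct vertices, $G$ is a disjoint union of cliques, $X_G$ is the
-- product of their chromatic symmetric functions, and a clique is the complement of an empty
-- matching. Otherwise $G$ has an induced path $a,b,c$. Being claw- and paw-free means that inside
-- each neighborhood every vertex has at most one non-neighbor; being co-paw-free means that every
-- vertex off an induced three-vertex path has a neighbor on it. From this
-- `structure_of_adj_conditions` deduces that $G$ is the complement of a matching, $P_4$ or $C_5$.
--
-- These graphs have no three pairwise nonadjacent vertices, so color classes have size at most two.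
-- On $n$ vertices, the coefficient in $X_G$ of a degree-$n$ monomial with $i$ squares and all other
-- exponents one is $(n-2i)!$ times the number of sequences of $i$ disjoint non-edges
-- (`coloringCount_eq`); in $e_{n-b}e_b$ it is $\binom{n-2i}{b-i}$ (`coeff_elementarySymm_mul`). It
-- remains to solve a triangular linear system in nonnegative integers: by induction on the number
-- of non-edges for complements of matchings (`exists_coeffs_descFactorial`), and numerically for
-- $P_4$ and $C_5$.

universe u

/-! ### The triangular system for complements of matchings -/

section Counting

open Finset
open scoped Nat

/-- Follows from $(b+1)(n-b+1)\binom{n+2}{b+1}=(n+2)(n+1)\binom nb$ and $(b+1)(n-b+1)\ge n+1$. It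
keeps the leading coefficient nonnegative in `exists_coeffs_descFactorial`. -/
theorem choose_add_two_succ_le (n b : ℕ) (hb : b ≤ n) :
    (n + 2).choose (b + 1) ≤ (n + 2) * n.choose b := by
  have h1 : (n + 2) * (n + 1).choose b = (n + 2).choose (b + 1) * (b + 1) :=
    Nat.add_one_mul_choose_eq (n + 1) b
  have h2 : (n + 1) * n.choose b = (n + 1).choose b * (n + 1 - b) := by
    rw [Nat.choose_mul_succ_eq n b |>.symm, mul_comm]
  obtain ⟨k, rfl⟩ := Nat.exists_eq_add_of_le hb
  rw [show b + k + 1 - b = k + 1 by omega] at h2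
  have h3 : (b + k + 2).choose (b + 1) * ((b + 1) * (k + 1)) =
      ((b + k + 2) * (b + k).choose b) * (b + k + 1) := by
    calc _ = (b + k + 2).choose (b + 1) * (b + 1) * (k + 1) := by ring
      _ = (b + k + 2) * ((b + k + 1).choose b * (k + 1)) := by rw [← h1]; ring
      _ = _ := by rw [← h2]; ring
  refine Nat.le_of_mul_le_mul_right (c := b + k + 1) ?_ (by omega)
  rw [← h3]
  exact Nat.mul_le_mul_left _ (by nlinarith)

/-- The coefficient of a monomial with `i` squares in `e_{n - b} e_b`, where `n` is its degree. -/
def squareCoeff (n i b : ℕ) : ℕ := if i ≤ b then (n - 2 * i).choose (b - i) else 0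

/-- Here $m$ is the number of non-edges. For $(m+1,n+2)$, equation $i+1$ is $m+1$ times equation $i$
for $(m,n)$ with the index $b$ shifted by one. So all coefficients but the first are inherited, and
equation $0$ determines the first. -/
theorem exists_coeffs_descFactorial (m n : ℕ) (h : 2 * m ≤ n) :
    ∃ c : ℕ → ℕ, ∀ i, 2 * i ≤ n →
      ∑ b ∈ range (n / 2 + 1), c b * squareCoeff n i b = (n - 2 * i)! * m.descFactorial i := by
  induction m generalizing n with
  | zero =>
    refine ⟨fun b => if b = 0 then n ! else 0, fun i _ => ?_⟩
    rcases i with _ | i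
    · simp [squareCoeff]
    · rw [Nat.zero_descFactorial_succ, mul_zero]
      refine sum_eq_zero fun b _ => ?_
      rcases b with _ | b <;> simp [squareCoeff]
  | succ m ih =>
    obtain ⟨n, rfl⟩ : ∃ k, n = k + 2 := ⟨n - 2, by omega⟩
    obtain ⟨c, hc⟩ := ih n (by omega)
    -- The subtraction is truncated; `key` below shows that nothing is cut off.
    refine ⟨fun b => Nat.casesOn b ((n + 2)! -
      ∑ b ∈ range (n / 2 + 1), (m + 1) * c b * (n + 2).choose (b + 1))
        fun b => (m + 1) * c b, fun i hi => ?_⟩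
    rw [show (n + 2) / 2 + 1 = n / 2 + 1 + 1 by omega, sum_range_succ']
    rcases i with _ | i
    · have key : ∑ b ∈ range (n / 2 + 1), (m + 1) * c b * (n + 2).choose (b + 1) ≤ (n + 2)! := by
        calc _ ≤ ∑ b ∈ range (n / 2 + 1), (m + 1) * (n + 2) * (c b * squareCoeff n 0 b) := by
              refine sum_le_sum fun b hb => ?_
              have := choose_add_two_succ_le n b (by simp at hb; omega)
              calc _ ≤ (m + 1) * c b * ((n + 2) * n.choose b) := Nat.mul_le_mul_left _ this
                _ = _ := by simp [squareCoeff]; ring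
          _ = (m + 1) * (n + 2) * n ! := by
              rw [← mul_sum, hc 0 (by omega)]; simp
          -- Uses $m\le n$, which holds because $2(m+1)\le n+2$.
          _ ≤ (n + 1) * (n + 2) * n ! := by gcongr; omega
          _ = _ := by rw [Nat.factorial_succ, Nat.factorial_succ]; ring
      simp only [squareCoeff, Nat.zero_le, if_true, mul_zero, Nat.sub_zero, Nat.choose_zero_right,
        mul_one, Nat.descFactorial_zero]
      exact Nat.add_sub_cancel' key
    · have := hc i (by omega)
      rw [show n + 2 - 2 * (i + 1) = n - 2 * i by omega, Nat.succ_descFactorial_succ,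
        mul_left_comm, ← this, mul_sum]
      simp [squareCoeff, show n + 2 - 2 * (i + 1) = n - 2 * i by omega, mul_assoc]

/-! ### Coefficients of products of two elementary symmetric functions -/

theorem coeff_monomialSum {ι : Type*} (m : ι → ℕ+ →₀ ℕ) (d : ℕ+ →₀ ℕ) :
    MvPowerSeries.coeff d (monomialSum m) = (Nat.card {i // m i = d} : ℤ) := rfl

theorem monomialSum_mul {ι κ : Type*} (m : ι → ℕ+ →₀ ℕ) (m' : κ → ℕ+ →₀ ℕ)
    (hm : ∀ d, Finite {i // m i = d}) (hm' : ∀ d, Finite {i // m' i = d}) :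
    monomialSum m * monomialSum m' = monomialSum fun p : ι × κ => m p.1 + m' p.2 := by
  classical
  ext d
  simp only [MvPowerSeries.coeff_mul, coeff_monomialSum]
  rw [← Finset.sum_coe_sort]
  norm_cast
  simp only [← Nat.card_prod]
  rw [← Nat.card_sigma]
  refine Nat.card_congr ⟨fun x => ⟨(x.2.1.1, x.2.2.1), ?_⟩,
    fun x => ⟨⟨(m x.1.1, m' x.1.2), ?_⟩, ⟨x.1.1, rfl⟩, ⟨x.1.2, rfl⟩⟩, ?_, ?_⟩
  · rw [x.2.1.2, x.2.2.2]
    exact mem_antidiagonal.mp x.1.2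
  · exact mem_antidiagonal.mpr x.2
  · rintro ⟨⟨⟨d₁, d₂⟩, hd⟩, ⟨i, hi⟩, ⟨j, hj⟩⟩
    dsimp at hi hj
    subst hi hj
    rfl
  · rintro ⟨⟨i, j⟩, h⟩
    rfl

theorem monomialSum_congr {ι κ : Type*} (e : ι ≃ κ) (m : ι → ℕ+ →₀ ℕ) (m' : κ → ℕ+ →₀ ℕ)
    (h : ∀ i, m i = m' (e i)) : monomialSum m = monomialSum m' := by
  ext d
  rw [coeff_monomialSum, coeff_monomialSum]
  congr 1
  exact Nat.card_congr (e.subtypeEquiv fun i => by rw [h])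

theorem indicator_apply (s : Finset ℕ+) (k : ℕ+) [Decidable (k ∈ s)] :
    (∑ j ∈ s, Finsupp.single j 1 : ℕ+ →₀ ℕ) k = if k ∈ s then 1 else 0 := by
  classical
  simp [Finsupp.finsetSum_apply, Finsupp.single_apply]

theorem indicator_degree (s : Finset ℕ+) :
    (∑ j ∈ s, Finsupp.single j 1 : ℕ+ →₀ ℕ).degree = #s := by
  simp [map_sum]

/-- The indices that occur with exponent two. -/
def squares (d : ℕ+ →₀ ℕ) : Finset ℕ+ := {j ∈ d.support | d j = 2}

theorem mem_squares {d : ℕ+ →₀ ℕ} {j : ℕ+} : j ∈ squares d ↔ d j = 2 := by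
  simp +contextual [squares]

theorem two_mul_card_squares_add (d : ℕ+ →₀ ℕ) (hd : ∀ j, d j ≤ 2) :
    2 * #(squares d) + #{j ∈ d.support | d j = 1} = d.degree := by
  rw [Finsupp.degree_apply, squares, card_filter, card_filter, mul_sum, ← sum_add_distrib]
  refine sum_congr rfl fun j hj => ?_
  have h1 := hd j
  have h2 := Finsupp.mem_support_iff.mp hj
  generalize d j = x at *
  interval_cases x <;> simp at *

open Classical in
-- A term of the product is a pair of sets $(s,t)$. Indices of exponent two lie in both sets, those
-- of exponent one in exactly one, so the pair is determined by which $b-i$ of the exponent-one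
-- indices go to $t$.
theorem coeff_elementarySymm_mul (a b : ℕ) (d : ℕ+ →₀ ℕ) :
    MvPowerSeries.coeff d (elementarySymm a * elementarySymm b) =
      ((if (∀ j, d j ≤ 2) ∧ d.degree = a + b then
        squareCoeff (a + b) #(squares d) b else 0 : ℕ) : ℤ) := by
  rw [elementarySymm, elementarySymm,
    monomialSum_mul _ _ (finite_finset_fiber a) (finite_finset_fiber b), coeff_monomialSum]
  norm_cast
  have hle : ∀ p : {s : Finset ℕ+ // #s = a} × {s : Finset ℕ+ // #s = b},
      (∑ j ∈ p.1.1, Finsupp.single j 1 : ℕ+ →₀ ℕ) + ∑ j ∈ p.2.1, Finsupp.single j 1 = d →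
      ((∀ j, d j ≤ 2) ∧ d.degree = a + b) ∧ #(squares d) ≤ b := by
    rintro ⟨⟨s, hs⟩, ⟨t, ht⟩⟩ rfl
    refine ⟨⟨fun j => ?_, ?_⟩, ?_⟩
    · simp only [Finsupp.add_apply, indicator_apply]
      split_ifs <;> omega
    · rw [map_add, indicator_degree, indicator_degree, hs, ht]
    · refine le_of_le_of_eq ?_ ht
      refine card_le_card fun j hj => ?_
      rw [mem_squares] at hj
      simp only [Finsupp.add_apply, indicator_apply] at hj
      by_contra h
      rw [if_neg h] at hj
      split_ifs at hj <;> omega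
  split_ifs with h
  swap
  · rw [Nat.card_eq_zero]
    exact Or.inl ⟨fun p => h (hle p.1 p.2).1⟩
  rw [squareCoeff]
  split_ifs with hb
  swap
  · rw [Nat.card_eq_zero]
    exact Or.inl ⟨fun p => hb (hle p.1 p.2).2⟩
  have hO := two_mul_card_squares_add d h.1
  rw [h.2] at hO
  set T := squares d with hT
  set O : Finset ℕ+ := {j ∈ d.support | d j = 1} with hO'
  have memO : ∀ j, j ∈ O ↔ d j = 1 := fun j => by simp +contextual [O]
  have memT : ∀ j, j ∈ T ↔ d j = 2 := fun j => mem_squares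
  have disj : ∀ u ⊆ O, Disjoint T u := fun u hu => by
    rw [Finset.disjoint_left]
    intro j h1 h2
    have := (memO j).1 (hu h2)
    have := (memT j).1 h1
    omega
  have hval : ∀ u ⊆ O, (∑ j ∈ T ∪ (O \ u), Finsupp.single j 1 : ℕ+ →₀ ℕ) +
      ∑ j ∈ T ∪ u, Finsupp.single j 1 = d := by
    intro u hu
    ext j
    have h1 := h.1 j
    have h2 := memO j
    have h3 := memT j
    have h4 := @hu j
    simp only [Finsupp.add_apply, indicator_apply, mem_union, mem_sdiff, h2, h3] at h4 ⊢
    by_cases h5 : j ∈ u <;> simp only [h5, forall_const] at h4 ⊢ <;>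
      generalize d j = x at * <;> interval_cases x <;> simp at *
  have hcard : ∀ u ∈ powersetCard (b - #T) O, #(T ∪ (O \ u)) = a ∧ #(T ∪ u) = b := by
    intro u hu
    obtain ⟨hu, hc⟩ := mem_powersetCard.1 hu
    have := card_le_card hu
    rw [card_union_of_disjoint (disj _ hu), card_union_of_disjoint (disj _ sdiff_subset),
      card_sdiff_of_subset hu]
    omega
  rw [show a + b - 2 * #T = #O by omega, ← card_powersetCard, ← Nat.card_eq_finsetCard]
  symm
  refine Nat.card_eq_of_bijective (fun u => ⟨⟨⟨T ∪ (O \ u.1), (hcard u.1 u.2).1⟩,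
    ⟨T ∪ u.1, (hcard u.1 u.2).2⟩⟩, hval u.1 (mem_powersetCard.1 u.2).1⟩) ⟨?_, ?_⟩
  · intro u u' huu
    have h1 := disj _ (mem_powersetCard.1 u.2).1
    have h2 := disj _ (mem_powersetCard.1 u'.2).1
    have h3 : T ∪ u.1 = T ∪ u'.1 := congrArg (fun p => p.1.2.1) huu
    refine Subtype.ext ?_
    rw [← union_sdiff_cancel_left h1, h3, union_sdiff_cancel_left h2]
  · rintro ⟨⟨⟨s, hs⟩, ⟨t, ht⟩⟩, hst⟩
    dsimp only at hst
    have hpt : ∀ j, (if j ∈ s then 1 else 0) + (if j ∈ t then 1 else 0) = d j := fun j => by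
      rw [← hst, Finsupp.add_apply, indicator_apply, indicator_apply]
    have hTt : T ⊆ t := fun j hj => by
      have h1 := hpt j
      rw [(memT j).1 hj] at h1
      split_ifs at h1 <;> first | assumption | omega
    have htO : t \ T ⊆ O := fun j hj => by
      rw [mem_sdiff, memT] at hj
      rw [memO]
      have h1 := hpt j
      rw [if_pos hj.1] at h1
      have := hj.2
      split_ifs at h1 <;> omega
    have hs' : T ∪ (O \ (t \ T)) = s := by
      ext j
      have h1 := hpt j
      simp only [mem_union, mem_sdiff, memO, memT, ← h1]
      by_cases h2 : j ∈ s <;> by_cases h3 : j ∈ t <;> simp [h2, h3]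
    refine ⟨⟨t \ T, mem_powersetCard.2 ⟨htO, by rw [card_sdiff_of_subset hTt, ht]⟩⟩, ?_⟩
    simp only [hs', union_sdiff_of_subset hTt]

/-! ### Counting colorings with classes of size at most two -/

variable {V : Type u} [Fintype V]

/-- The number of proper colorings in which each color `j` is used `d j` times. -/
noncomputable def coloringCount (G : SimpleGraph V) (d : ℕ+ →₀ ℕ) : ℕ :=
  Nat.card {κ : G.Coloring ℕ+ // ∑ v, Finsupp.single (κ v) 1 = d}

theorem coeff_chromaticSymmetricFunction (G : SimpleGraph V) (d : ℕ+ →₀ ℕ) :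
    MvPowerSeries.coeff d (chromaticSymmetricFunction G) = (coloringCount G d : ℤ) := rfl

theorem content_apply (κ : V → ℕ+) (j : ℕ+) :
    (∑ v, Finsupp.single (κ v) 1 : ℕ+ →₀ ℕ) j = #{v | κ v = j} := by
  simp [Finsupp.finsetSum_apply, Finsupp.single_apply]

theorem content_degree (κ : V → ℕ+) :
    (∑ v, Finsupp.single (κ v) 1 : ℕ+ →₀ ℕ).degree = Fintype.card V := by
  simp [map_sum]

theorem coloringCount_eq_zero_of_degree_ne (G : SimpleGraph V) (d : ℕ+ →₀ ℕ)
    (h : d.degree ≠ Fintype.card V) : coloringCount G d = 0 := by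
  rw [coloringCount, Nat.card_eq_zero]
  refine Or.inl ⟨fun κ => h ?_⟩
  rw [← κ.2, content_degree]

/-- `G` has no three pairwise nonadjacent vertices. -/
def NoStableTriple {V : Type u} (G : SimpleGraph V) : Prop :=
  ∀ x y z, x ≠ y → x ≠ z → y ≠ z → G.Adj x y ∨ G.Adj x z ∨ G.Adj y z

theorem coloringCount_eq_zero_of_lt (G : SimpleGraph V) (hG : NoStableTriple G)
    (d : ℕ+ →₀ ℕ) (h : ¬ ∀ j, d j ≤ 2) : coloringCount G d = 0 := by
  rw [coloringCount, Nat.card_eq_zero]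
  refine Or.inl ⟨fun ⟨κ, hκ⟩ => h fun j => ?_⟩
  by_contra! hj
  rw [← hκ, content_apply, two_lt_card] at hj
  obtain ⟨x, hx, y, hy, z, hz, hxy, hxz, hyz⟩ := hj
  simp only [mem_filter, mem_univ, true_and] at hx hy hz
  rcases hG x y z hxy hxz hyz with h | h | h
  · exact κ.valid h (hx.trans hy.symm)
  · exact κ.valid h (hx.trans hz.symm)
  · exact κ.valid h (hy.trans hz.symm)

/-- With every color used at most once, colorings are bijections from the vertices to the support of
`d`, and properness is automatic. -/
theorem coloringCount_eq_factorial (G : SimpleGraph V) (d : ℕ+ →₀ ℕ) (hd : ∀ j, d j ≤ 1)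
    (hn : d.degree = Fintype.card V) : coloringCount G d = (Fintype.card V)! := by
  classical
  have hone : ∀ j ∈ d.support, d j = 1 := fun j hj =>
    le_antisymm (hd j) (Nat.one_le_iff_ne_zero.2 (Finsupp.mem_support_iff.1 hj))
  have hcard : Fintype.card V = Fintype.card d.support := by
    rw [← hn, Finsupp.degree_apply, Fintype.card_coe, sum_congr rfl hone, card_eq_sum_ones]
  rw [← Fintype.card_equiv (Fintype.equivOfCardEq hcard), ← Nat.card_eq_fintype_card]
  symm
  refine Nat.card_eq_of_bijective (fun e : V ≃ d.support =>
    ⟨SimpleGraph.Coloring.mk (fun v => (e v : ℕ+)) fun h he =>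
      h.ne (e.injective (Subtype.ext he)), ?_⟩) ⟨?_, ?_⟩
  · change ∑ v, Finsupp.single (e v : ℕ+) 1 = d
    rw [Equiv.sum_comp e fun j : d.support => Finsupp.single (j : ℕ+) 1,
      sum_coe_sort d.support fun j => Finsupp.single j 1]
    conv_rhs => rw [← Finsupp.sum_single d]
    exact sum_congr rfl fun j hj => by rw [hone j hj]
  · intro e e' h
    exact Equiv.ext fun v => Subtype.ext (congrArg (fun κ => (κ.1 v : ℕ+)) h)
  · rintro ⟨κ, hκ⟩
    have hmem : ∀ v, κ v ∈ d.support := fun v => by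
      rw [Finsupp.mem_support_iff, ← hκ, content_apply, ← Nat.pos_iff_ne_zero, card_pos]
      exact ⟨v, by simp⟩
    have hinj : Function.Injective fun v => (⟨κ v, hmem v⟩ : d.support) := by
      intro v w hvw
      have := hd (κ v)
      rw [← hκ, content_apply, card_le_one] at this
      exact this v (by simp) w (by simpa using (Subtype.ext_iff.1 hvw).symm)
    refine ⟨Equiv.ofBijective _ ((Fintype.bijective_iff_injective_and_card _).2 ⟨hinj, hcard⟩), ?_⟩
    rfl

/-- The graph that remains when the ends of an unordered pair are deleted. -/
abbrev deletePair {V : Type u} (G : SimpleGraph V) (e : Sym2 V) : SimpleGraph {v // v ∉ e} :=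
  G.comap Subtype.val

theorem sum_single_eq_deletePair_add (κ : V → ℕ+) {a b : V} (hab : a ≠ b) (j : ℕ+)
    [Fintype {v // v ∉ s(a, b)}] (h : ∀ v ∈ s(a, b), κ v = j) :
    (∑ v, Finsupp.single (κ v) 1 : ℕ+ →₀ ℕ) =
      ∑ v : {v // v ∉ s(a, b)}, Finsupp.single (κ v) 1 + Finsupp.single j 2 := by
  classical
  rw [← Finset.sum_compl_add_sum {a, b}, sum_pair hab, h a (by simp), h b (by simp),
    ← Finsupp.single_add]
  congr 1
  exact sum_subtype _ (fun v => by simp) _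

/-- The two vertices colored `j` form a non-edge; deleting them leaves a proper coloring that avoids
`j`. Conversely, such data glue to a coloring. -/
theorem coloringCount_eq_sum [DecidableEq V] (G : SimpleGraph V) [DecidableRel G.Adj]
    (d : ℕ+ →₀ ℕ) (j : ℕ+) (hj : d j = 2) :
    coloringCount G d = ∑ e ∈ Gᶜ.edgeFinset, coloringCount (deletePair G e) (d.erase j) := by
  rw [← sum_coe_sort]
  have hfin : ∀ e : Gᶜ.edgeFinset, Finite
      {κ : (deletePair G e).Coloring ℕ+ // ∑ v, Finsupp.single (κ v) 1 = d.erase j} :=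
    fun e => finite_coloring_fiber _ _
  simp only [coloringCount]
  rw [← Nat.card_sigma]
  symm
  -- Since `j` does not occur off `e`, the glued coloring is proper and `e` can be recovered as its
  -- class of color `j`.
  have hne : ∀ (e : Gᶜ.edgeFinset) (κ : (deletePair G e).Coloring ℕ+),
      ∑ v, Finsupp.single (κ v) 1 = d.erase j → ∀ v, κ v ≠ j := by
    intro e κ hκ v hv
    have := content_apply κ j
    rw [hκ, Finsupp.erase_same] at this
    exact (card_pos.2 ⟨v, by simpa using hv⟩).ne this
  refine Nat.card_eq_of_bijective (fun x => ⟨SimpleGraph.Coloring.mk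
    (fun v => if h : v ∈ x.1.1 then j else x.2.1 ⟨v, h⟩) ?_, ?_⟩) ⟨?_, ?_⟩
  · obtain ⟨e, κ, hκ⟩ := x
    intro v w hvw
    have he := SimpleGraph.mem_edgeFinset.1 e.2
    by_cases h1 : v ∈ e.1 <;> by_cases h2 : w ∈ e.1
    · rw [(Sym2.mem_and_mem_iff hvw.ne).1 ⟨h1, h2⟩] at he
      exact absurd hvw he.2
    · simpa [h1, h2] using (hne e κ hκ _).symm
    · simpa [h1, h2] using hne e κ hκ _
    · simpa [h1, h2] using κ.valid (show (deletePair G e).Adj ⟨v, h1⟩ ⟨w, h2⟩ from hvw)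
  · obtain ⟨⟨e, he⟩, κ, hκ⟩ := x
    induction e with | _ a b => ?_
    have hab := (SimpleGraph.mem_edgeFinset.1 he).1
    refine (sum_single_eq_deletePair_add (fun v => if h : v ∈ s(a, b) then j else κ ⟨v, h⟩)
      hab j fun v hv => dif_pos hv).trans ?_
    rw [← Finsupp.erase_add_single j d, hj, ← hκ]
    congr 1
    exact sum_congr rfl fun v _ => by rw [dif_neg v.2]
  · rintro ⟨⟨e, he⟩, κ, hκ⟩ ⟨⟨e', he'⟩, κ', hκ'⟩ h
    have hpt : ∀ v, (if h : v ∈ e then j else κ ⟨v, h⟩) = if h : v ∈ e' then j else κ' ⟨v, h⟩ :=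
      fun v => congrArg (fun κ => κ.1 v) h
    have hee : e = e' := by
      refine Sym2.ext fun v => ?_
      have h1 := hpt v
      by_cases hv : v ∈ e <;> by_cases hv' : v ∈ e' <;> simp [hv, hv'] at h1 ⊢
      · exact hne _ κ' hκ' _ h1.symm
      · exact hne _ κ hκ _ h1
    subst hee
    congr 2
    ext v
    have h1 := hpt v
    rw [dif_neg v.2, dif_neg v.2] at h1
    rw [h1]
  · rintro ⟨κ, hκ⟩
    have h2 := content_apply κ j
    rw [hκ, hj, eq_comm, card_eq_two] at h2
    obtain ⟨a, b, hab, hs⟩ := h2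
    have hmem : ∀ v, κ v = j ↔ v ∈ s(a, b) := fun v => by
      have := congrArg (v ∈ ·) hs
      simpa using this
    have he : s(a, b) ∈ Gᶜ.edgeFinset := by
      rw [SimpleGraph.mem_edgeFinset, SimpleGraph.mem_edgeSet, SimpleGraph.compl_adj]
      refine ⟨hab, fun h => κ.valid h ?_⟩
      rw [(hmem a).2 (by simp), (hmem b).2 (by simp)]
    refine ⟨⟨⟨s(a, b), he⟩, SimpleGraph.Coloring.mk (fun v => κ v) fun h => κ.valid h, ?_⟩, ?_⟩
    · have h3 := sum_single_eq_deletePair_add κ hab j fun v hv => (hmem v).2 hv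
      rw [← hκ, h3, Finsupp.erase_add, Finsupp.erase_single, add_zero,
        Finsupp.erase_of_notMem_support]
      · rfl
      · rw [Finsupp.notMem_support_iff, content_apply (fun v : {v // v ∉ s(a, b)} => κ v),
          card_eq_zero, filter_eq_empty_iff]
        exact fun v _ hv => v.2 ((hmem v).1 hv)
    · refine Subtype.ext (RelHom.ext fun v => ?_)
      by_cases h : v ∈ s(a, b)
      · exact (dif_pos h).trans ((hmem v).2 h).symm
      · exact dif_neg h

/-- The number of sequences of `i` pairwise disjoint pairs of nonadjacent vertices. -/
def stablePairSeqCount : (i : ℕ) → {V : Type u} → [Fintype V] → [DecidableEq V] →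
    (G : SimpleGraph V) → [DecidableRel G.Adj] → ℕ
  | 0, _, _, _, _, _ => 1
  | i + 1, _, _, _, G, _ => ∑ e ∈ Gᶜ.edgeFinset, stablePairSeqCount i (deletePair G e)

theorem card_deletePair [DecidableEq V] (G : SimpleGraph V) [DecidableRel G.Adj] (e : Sym2 V)
    (he : e ∈ Gᶜ.edgeFinset) : Fintype.card {v // v ∉ e} + 2 = Fintype.card V := by
  induction e with | _ a b => ?_
  have hab := (SimpleGraph.mem_edgeFinset.1 he).1
  rw [← card_pair hab, Fintype.card_of_subtype ({a, b} : Finset V)ᶜ fun v => by simp,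
    card_compl_add_card]

/-- Remove the doubly used colors one at a time with `coloringCount_eq_sum`; the remaining $n-2i$
vertices receive distinct colors. -/
theorem coloringCount_eq [DecidableEq V] (G : SimpleGraph V) [DecidableRel G.Adj]
    (hG : NoStableTriple G) (d : ℕ+ →₀ ℕ) (hd : ∀ j, d j ≤ 2)
    (hn : d.degree = Fintype.card V) (i : ℕ) (hi : #(squares d) = i) :
    coloringCount G d = (Fintype.card V - 2 * i)! * stablePairSeqCount i G := by
  induction i generalizing V d with
  | zero =>
    rw [stablePairSeqCount, coloringCount_eq_factorial G d _ hn, mul_zero, Nat.sub_zero, mul_one]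
    intro j
    by_contra! h
    rw [card_eq_zero] at hi
    exact notMem_empty j (hi ▸ mem_squares.2 (le_antisymm (hd j) h))
  | succ i ih =>
    obtain ⟨j, hj⟩ := card_pos.1 (i.succ_pos.trans_eq hi.symm)
    have hj2 := mem_squares.1 hj
    rw [coloringCount_eq_sum G d j hj2, stablePairSeqCount, mul_sum]
    refine sum_congr rfl fun e he => ?_
    have hcard := card_deletePair G e he
    have hsq : squares (d.erase j) = (squares d).erase j := by
      ext k
      rw [mem_erase, mem_squares, mem_squares, Finsupp.erase_apply]
      split_ifs with h <;> simp [h]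
    have hdeg := congrArg Finsupp.degree (Finsupp.erase_add_single j d)
    rw [map_add, Finsupp.degree_single, hj2, hn, ← hcard] at hdeg
    rw [ih (deletePair G e) (fun x y z hxy hxz hyz => hG x y z (Subtype.coe_ne_coe.2 hxy)
      (Subtype.coe_ne_coe.2 hxz) (Subtype.coe_ne_coe.2 hyz)) (d.erase j) _ (by omega) _]
    · congr 2
      omega
    · intro k
      rw [Finsupp.erase_apply]
      split_ifs
      · omega
      · exact hd k
    · rw [hsq, card_erase_of_mem hj, hi, Nat.add_sub_cancel]

/-! ### Closure properties of e-positivity and the coefficient criterion -/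

theorem IsEPositive.zero : IsEPositive 0 := ⟨0, by simp, by simp⟩

theorem IsEPositive.add {f g : MvPowerSeries ℕ+ ℤ} (hf : IsEPositive f) (hg : IsEPositive g) :
    IsEPositive (f + g) := by
  classical
  obtain ⟨c, hc, rfl⟩ := hf
  obtain ⟨c', hc', rfl⟩ := hg
  exact ⟨c + c', fun p => add_nonneg (hc p) (hc' p),
    (Finsupp.sum_add_index' (h := fun (p : Σ n : ℕ, n.Partition) (a : ℤ) => a • elementarySymmPart p.2)
      (fun _ => zero_smul _ _) fun _ _ _ => add_smul _ _ _).symm⟩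

theorem IsEPositive.sum {ι : Type*} (s : Finset ι) (f : ι → MvPowerSeries ℕ+ ℤ)
    (h : ∀ i ∈ s, IsEPositive (f i)) : IsEPositive (∑ i ∈ s, f i) :=
  sum_induction f IsEPositive (fun _ _ => IsEPositive.add) IsEPositive.zero h

theorem IsEPositive.zsmul {f : MvPowerSeries ℕ+ ℤ} (hf : IsEPositive f) (a : ℤ) (ha : 0 ≤ a) :
    IsEPositive (a • f) := by
  obtain ⟨c, hc, rfl⟩ := hf
  refine ⟨a • c, fun p => mul_nonneg ha (hc p), ?_⟩
  rw [Finsupp.sum_smul_index' (h := fun (p : Σ n : ℕ, n.Partition) (a : ℤ) => a • elementarySymmPart p.2)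
    fun _ => zero_smul _ _, Finsupp.smul_sum]
  simp only [smul_eq_mul, mul_smul]

theorem isEPositive_elementarySymmPart {n : ℕ} (p : n.Partition) :
    IsEPositive (elementarySymmPart p) := by
  classical
  refine ⟨Finsupp.single ⟨n, p⟩ 1, fun q => ?_, ?_⟩
  · rw [Finsupp.single_apply]
    split_ifs <;> simp
  · rw [Finsupp.sum_single_index (h := fun (p : Σ n : ℕ, n.Partition) (a : ℤ) => a • elementarySymmPart p.2) (zero_smul _ _),
      one_smul]

theorem elementarySymmPart_mul {n m : ℕ} (p : n.Partition) (q : m.Partition) :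
    IsEPositive (elementarySymmPart p * elementarySymmPart q) := by
  have h : elementarySymmPart p * elementarySymmPart q = elementarySymmPart
      (⟨p.parts + q.parts, fun h => (Multiset.mem_add.1 h).elim p.parts_pos q.parts_pos,
        by rw [Multiset.sum_add, p.parts_sum, q.parts_sum]⟩ : (n + m).Partition) := by
    simp [elementarySymmPart]
  rw [h]
  exact isEPositive_elementarySymmPart _

theorem IsEPositive.mul {f g : MvPowerSeries ℕ+ ℤ} (hf : IsEPositive f) (hg : IsEPositive g) :
    IsEPositive (f * g) := by
  obtain ⟨c, hc, rfl⟩ := hf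
  obtain ⟨c', hc', rfl⟩ := hg
  rw [Finsupp.sum, Finsupp.sum, sum_mul_sum]
  refine IsEPositive.sum _ _ fun p _ => IsEPositive.sum _ _ fun q _ => ?_
  rw [smul_mul_smul_comm]
  exact (elementarySymmPart_mul _ _).zsmul _ (mul_nonneg (hc p) (hc' q))

theorem elementarySymm_zero : elementarySymm 0 = 1 := by
  classical
  ext d
  rw [elementarySymm, coeff_monomialSum, MvPowerSeries.coeff_one]
  split_ifs with h
  · subst h
    norm_cast
    rw [Nat.card_eq_one_iff_unique]
    refine ⟨⟨fun s t => ?_⟩, ⟨⟨∅, rfl⟩, by simp⟩⟩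
    have h1 := card_eq_zero.1 s.1.2
    have h2 := card_eq_zero.1 t.1.2
    exact Subtype.ext (Subtype.ext (h1.trans h2.symm))
  · norm_cast
    rw [Nat.card_eq_zero]
    refine Or.inl ⟨fun s => h ?_⟩
    have h2 := s.2
    rw [card_eq_zero.1 s.1.2, sum_empty] at h2
    exact h2.symm

theorem isEPositive_elementarySymm (k : ℕ) : IsEPositive (elementarySymm k) := by
  have h : elementarySymm k = elementarySymmPart (Nat.Partition.indiscrete k) := by
    rcases k with _ | k
    · simp [elementarySymmPart, elementarySymm_zero]
    · simp [elementarySymmPart, Nat.Partition.indiscrete_parts]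
  rw [h]
  exact isEPositive_elementarySymmPart _

/-- The hypothesis on `c` is the equality of coefficients in $X_G=\sum_b c_b\,e_{n-b}e_b$, one
equation for each number $i$ of squares. At all other monomials both sides vanish. -/
theorem isEPositive_of_stablePairSeqCount [DecidableEq V] (G : SimpleGraph V) [DecidableRel G.Adj]
    (hG : NoStableTriple G) (c : ℕ → ℕ)
    (hc : ∀ i, 2 * i ≤ Fintype.card V →
      ∑ b ∈ range (Fintype.card V / 2 + 1), c b * squareCoeff (Fintype.card V) i b =
        (Fintype.card V - 2 * i)! * stablePairSeqCount i G) :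
    IsEPositive (chromaticSymmetricFunction G) := by
  classical
  set n := Fintype.card V
  have h : chromaticSymmetricFunction G = ∑ b ∈ range (n / 2 + 1),
      (c b : ℤ) • (elementarySymm (n - b) * elementarySymm b) := by
    ext d
    rw [coeff_chromaticSymmetricFunction, map_sum]
    have : ∀ b ∈ range (n / 2 + 1), MvPowerSeries.coeff d
        ((c b : ℤ) • (elementarySymm (n - b) * elementarySymm b)) =
        ((c b * if (∀ j, d j ≤ 2) ∧ d.degree = n then squareCoeff n #(squares d) b else 0 : ℕ) :
          ℤ) := by
      intro b hb
      rw [map_smul, coeff_elementarySymm_mul, Nat.sub_add_cancel (by simp at hb; omega)]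
      simp
    rw [sum_congr rfl this]
    norm_cast
    split_ifs with hd
    · have := two_mul_card_squares_add d hd.1
      rw [coloringCount_eq G hG d hd.1 hd.2 _ rfl, hc _ (by omega)]
    · simp only [mul_zero, sum_const_zero]
      by_cases h2 : ∀ j, d j ≤ 2
      · exact coloringCount_eq_zero_of_degree_ne G d fun h3 => hd ⟨h2, h3⟩
      · exact coloringCount_eq_zero_of_lt G hG d h2
  rw [h]
  exact IsEPositive.sum _ _ fun b _ =>
    ((isEPositive_elementarySymm _).mul (isEPositive_elementarySymm _)).zsmul _ (by positivity)

theorem chromaticSymmetricFunction_congr {W : Type*} [Fintype W] {G : SimpleGraph V}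
    {H : SimpleGraph W} (e : G ≃g H) :
    chromaticSymmetricFunction G = chromaticSymmetricFunction H := by
  refine monomialSum_congr ⟨fun κ => κ.comp e.symm.toHom, fun κ => κ.comp e.toHom,
    fun κ => RelHom.ext fun v => by simp, fun κ => RelHom.ext fun v => by simp⟩ _ _ fun κ => ?_
  exact (Equiv.sum_comp e.toEquiv.symm fun v => Finsupp.single (κ v) 1).symm

end Counting

/-! ### The e-positive families -/

section Families

open Finset
open scoped Nat

variable {V : Type u}

theorem IsInducedFree.not_iff {W : Type*} {H : SimpleGraph W} {G : SimpleGraph V}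
    (hG : IsInducedFree H G) (f : W → V) (hf : ∀ i j, f i = f j → i = j)
    (h : ∀ i j, G.Adj (f i) (f j) ↔ H.Adj i j) : False :=
  hG ⟨⟨⟨f, fun i j => hf i j⟩, fun {i j} => h i j⟩⟩

variable [Fintype V]

/-- The path with four vertices. -/
abbrev pathFour : SimpleGraph (Fin 4) := SimpleGraph.fromRel fun i j => i.val + 1 = j.val

/-- The expansion is $4e_4+2e_3e_1+2e_2e_2$. -/
theorem isEPositive_pathFour :
    IsEPositive (chromaticSymmetricFunction pathFour) := by
  have h : ∀ i, 2 * i ≤ 4 →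
      ∑ b ∈ range (4 / 2 + 1), [4, 2, 2].getD b 0 * squareCoeff 4 i b =
        (4 - 2 * i)! * stablePairSeqCount i pathFour := by
    intro i hi
    have : i ≤ 2 := by omega
    interval_cases i <;> decide +kernel
  exact isEPositive_of_stablePairSeqCount _ (by unfold NoStableTriple; decide) (fun b => [4, 2, 2].getD b 0) h

/-- The expansion is $20e_5+10e_3e_2$. -/
theorem isEPositive_cycleGraph_five :
    IsEPositive (chromaticSymmetricFunction (SimpleGraph.cycleGraph 5)) := by
  have h : ∀ i, 2 * i ≤ 5 →
      ∑ b ∈ range (5 / 2 + 1), [20, 0, 10].getD b 0 * squareCoeff 5 i b =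
        (5 - 2 * i)! * stablePairSeqCount i (SimpleGraph.cycleGraph 5) := by
    intro i hi
    have : i ≤ 2 := by omega
    interval_cases i <;> decide +kernel
  exact isEPositive_of_stablePairSeqCount _ (by unfold NoStableTriple; decide) (fun b => [20, 0, 10].getD b 0) h

/-- Every vertex of `G` has at most one non-neighbor. -/
def IsCoMatching {V : Type u} (G : SimpleGraph V) : Prop :=
  ∀ x y z, x ≠ y → x ≠ z → y ≠ z → G.Adj x y ∨ G.Adj x z

theorem IsCoMatching.comap {V W : Type u} {G : SimpleGraph V} (hG : IsCoMatching G) (f : W ↪ V) :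
    IsCoMatching (G.comap f) := fun x y z hxy hxz hyz =>
  hG (f x) (f y) (f z) (f.injective.ne hxy) (f.injective.ne hxz) (f.injective.ne hyz)

/-- Distinct non-edges are disjoint, so deleting the ends of one destroys no other. -/
theorem IsCoMatching.card_compl_edges_deletePair [DecidableEq V] (G : SimpleGraph V)
    [DecidableRel G.Adj] (hG : IsCoMatching G) (e : Sym2 V) (he : e ∈ Gᶜ.edgeFinset) :
    #(deletePair G e)ᶜ.edgeFinset + 1 = #Gᶜ.edgeFinset := by
  rw [← card_erase_add_one he, Nat.add_right_cancel_iff,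
    ← card_map (Function.Embedding.subtype _).sym2Map]
  congr 1
  ext f
  rw [mem_map, mem_erase]
  induction e with | _ a b => ?_
  rw [SimpleGraph.mem_edgeFinset, SimpleGraph.mem_edgeSet, SimpleGraph.compl_adj] at he
  constructor
  · rintro ⟨g, hg, rfl⟩
    induction g with | _ x y => ?_
    rw [SimpleGraph.mem_edgeFinset, SimpleGraph.mem_edgeSet, SimpleGraph.compl_adj] at hg
    refine ⟨fun h => x.2 ?_, ?_⟩
    · exact (Sym2.ext_iff.1 h _).1 (Sym2.mem_mk_left _ _)
    · simpa [Subtype.ext_iff] using hg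
  · rintro ⟨hne, hf⟩
    induction f with | _ x y => ?_
    rw [SimpleGraph.mem_edgeFinset, SimpleGraph.mem_edgeSet, SimpleGraph.compl_adj] at hf
    have hx : x ∉ s(a, b) := by
      intro hx
      have := hG x y
      have := hG a b
      have := hG b a
      have := G.adj_comm
      grind
    have hy : y ∉ s(a, b) := by
      intro hy
      have := hG y x
      have := hG a b
      have := hG b a
      have := G.adj_comm
      grind
    refine ⟨s(⟨x, hx⟩, ⟨y, hy⟩), ?_, rfl⟩
    rw [SimpleGraph.mem_edgeFinset, SimpleGraph.mem_edgeSet, SimpleGraph.compl_adj]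
    simpa [Subtype.ext_iff] using hf

theorem IsCoMatching.two_mul_card_le [DecidableEq V] (G : SimpleGraph V)
    [DecidableRel G.Adj] (hG : IsCoMatching G) : 2 * #Gᶜ.edgeFinset ≤ Fintype.card V := by
  rw [← SimpleGraph.sum_degrees_eq_twice_card_edges, ← card_univ, card_eq_sum_ones]
  refine sum_le_sum fun x _ => ?_
  rw [← SimpleGraph.card_neighborFinset_eq_degree, card_le_one]
  intro y hy z hz
  rw [SimpleGraph.mem_neighborFinset, SimpleGraph.compl_adj] at hy hz
  by_contra hyz
  exact (hG x y z hy.1 hz.1 hyz).elim hy.2 hz.2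

theorem IsCoMatching.stablePairSeqCount_eq [DecidableEq V] (G : SimpleGraph V)
    [DecidableRel G.Adj] (hG : IsCoMatching G) (i : ℕ) :
    stablePairSeqCount i G = (#Gᶜ.edgeFinset).descFactorial i := by
  induction i generalizing V with
  | zero => simp [stablePairSeqCount]
  | succ i ih =>
    rw [stablePairSeqCount]
    rcases h : #Gᶜ.edgeFinset with _ | m
    · rw [card_eq_zero.1 h]
      simp
    · rw [Nat.succ_descFactorial_succ, ← h, ← smul_eq_mul, ← sum_const]
      refine sum_congr rfl fun e he => ?_
      have := IsCoMatching.card_compl_edges_deletePair G hG e he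
      rw [ih (deletePair G e) (hG.comap (Function.Embedding.subtype _)),
        show #(deletePair G e)ᶜ.edgeFinset = m by omega]

theorem IsCoMatching.isEPositive {G : SimpleGraph V} (hG : IsCoMatching G) :
    IsEPositive (chromaticSymmetricFunction G) := by
  classical
  obtain ⟨c, hc⟩ := exists_coeffs_descFactorial #Gᶜ.edgeFinset (Fintype.card V)
    (IsCoMatching.two_mul_card_le G hG)
  refine isEPositive_of_stablePairSeqCount G (fun x y z hxy hxz hyz => ?_) c fun i hi => ?_
  · exact (hG x y z hxy hxz hyz).imp_right Or.inl
  · rw [hc i hi, IsCoMatching.stablePairSeqCount_eq G hG]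

/-- As no edge crosses the partition, a proper coloring is an arbitrary pair of proper colorings of
the two sides. -/
theorem chromaticSymmetricFunction_eq_mul (G : SimpleGraph V) (p : V → Prop)
    [DecidablePred p] (h : ∀ v w, p v → ¬ p w → ¬ G.Adj v w) :
    chromaticSymmetricFunction G =
      chromaticSymmetricFunction (G.comap (Subtype.val : {v // p v} → V)) *
        chromaticSymmetricFunction (G.comap (Subtype.val : {v // ¬ p v} → V)) := by
  classical
  rw [chromaticSymmetricFunction, chromaticSymmetricFunction, chromaticSymmetricFunction,
    monomialSum_mul _ _ (finite_coloring_fiber _) (finite_coloring_fiber _)]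
  refine monomialSum_congr ⟨fun κ => (κ.comp (SimpleGraph.Embedding.comap (.subtype _) G).toHom,
    κ.comp (SimpleGraph.Embedding.comap (.subtype _) G).toHom), fun κ =>
      SimpleGraph.Coloring.mk (fun v => if hv : p v then κ.1 ⟨v, hv⟩ else κ.2 ⟨v, hv⟩) ?_,
      ?_, ?_⟩ _ _ fun κ => ?_
  · intro v w hvw
    by_cases hv : p v <;> by_cases hw : p w
    · simpa [hv, hw] using κ.1.map_rel (a := ⟨v, hv⟩) (b := ⟨w, hw⟩) hvw
    · exact absurd hvw (h v w hv hw)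
    · exact absurd hvw.symm (h w v hw hv)
    · simpa [hv, hw] using κ.2.map_rel (a := ⟨v, hv⟩) (b := ⟨w, hw⟩) hvw
  · intro κ
    refine RelHom.ext fun v => ?_
    change (if hv : p v then κ v else κ v) = κ v
    simp
  · rintro ⟨κ, κ'⟩
    refine Prod.ext (RelHom.ext fun v => ?_) (RelHom.ext fun v => ?_)
    · exact dif_pos v.2
    · exact dif_neg v.2
  · exact (Fintype.sum_subtype_add_sum_subtype p fun v => Finsupp.single (κ v) 1).symm

/-- The closed neighborhood of a vertex is a clique with no edges leaving it; split it off and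
induct on the number of vertices. -/
theorem isEPositive_of_cluster (G : SimpleGraph V)
    (hG : ∀ a b c, G.Adj a b → G.Adj b c → a ≠ c → G.Adj a c) :
    IsEPositive (chromaticSymmetricFunction G) := by
  classical
  induction hn : Fintype.card V using Nat.strong_induction_on generalizing V with
  | _ n ih =>
    rcases isEmpty_or_nonempty V with hV | ⟨⟨a⟩⟩
    · exact IsCoMatching.isEPositive fun x => (hV.false x).elim
    · rw [chromaticSymmetricFunction_eq_mul G (fun v => v = a ∨ G.Adj a v)]
      · refine IsEPositive.mul (IsCoMatching.isEPositive ?_) (ih _ ?_ _ ?_ rfl)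
        · rintro ⟨x, hx⟩ ⟨y, hy⟩ _ hxy _ _
          have hxy' : x ≠ y := fun h => hxy (Subtype.ext h)
          left
          change G.Adj x y
          rcases hx with rfl | hx <;> rcases hy with rfl | hy
          · exact absurd rfl hxy'
          · exact hy
          · exact hx.symm
          · exact hG x a y hx.symm hy hxy'
        · rw [← hn]
          exact Fintype.card_subtype_lt (x := a) (by simp)
        · exact fun x y z hxy hyz hxz => hG x y z hxy hyz fun h => hxz (Subtype.ext h)
      · rintro v w (rfl | hv) hw hvw
        · exact hw (Or.inr hvw)
        · exact hw ((eq_or_ne w a).imp_right fun hwa => hG a v w hv hvw hwa.symm)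

/-! ### From forbidden subgraphs to the structure of the graph -/

/-- If `x` missed both `y` and `z`, the four vertices would induce a paw or a claw, according to
whether `y` and `z` are adjacent. -/
theorem adj_or_adj_of_claw_paw_free {V : Type u} {G : SimpleGraph V}
    (hclaw : IsInducedFree clawGraph G) (hpaw : IsInducedFree pawGraph G) {a x y z : V}
    (hx : G.Adj a x) (hy : G.Adj a y) (hz : G.Adj a z) (hxy : x ≠ y) (hxz : x ≠ z) (hyz : y ≠ z) :
    G.Adj x y ∨ G.Adj x z := by
  by_contra! h
  by_cases hadj : G.Adj y z
  · refine hpaw.not_iff ![x, a, y, z] ?_ ?_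
    · intro i j
      fin_cases i <;> fin_cases j <;>
        simp [hx.ne, hy.ne, hz.ne, hxy, hxz, hyz, hx.ne', hy.ne', hz.ne', hxy.symm, hxz.symm,
          hyz.symm]
    · intro i j
      fin_cases i <;> fin_cases j <;>
        simp [pawGraph, hx, hy, hz, hx.symm, hy.symm, hz.symm, hadj, hadj.symm, h, G.adj_comm y x,
          G.adj_comm z x]
  · refine hclaw.not_iff (Sum.elim ![a] ![x, y, z]) ?_ ?_
    · rintro (i | i) (j | j) <;> fin_cases i <;> fin_cases j <;>
      simp [hx.ne, hy.ne, hz.ne, hxy, hxz, hyz, hx.ne', hy.ne', hz.ne', hxy.symm, hxz.symm,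
        hyz.symm]
    · rintro (i | i) (j | j) <;> fin_cases i <;> fin_cases j <;>
      simp [clawGraph, hx, hy, hz, hx.symm, hy.symm, hz.symm, hadj, h, G.adj_comm y x,
        G.adj_comm z x, G.adj_comm z y]

theorem adj_of_copaw_free {V : Type u} {G : SimpleGraph V}
    (hcopaw : IsInducedFree copawGraph G) {a b c v : V}
    (hab : G.Adj a b) (hbc : G.Adj b c) (hac : ¬ G.Adj a c) (hne : a ≠ c) (hva : v ≠ a)
    (hvb : v ≠ b) (hvc : v ≠ c) : G.Adj v a ∨ G.Adj v b ∨ G.Adj v c := by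
  by_contra! h
  obtain ⟨h1, h2, h3⟩ := h
  -- In `copawGraph`, vertex 1 is isolated and 0 is the middle of the path 2, 0, 3.
  refine hcopaw.not_iff ![b, v, a, c] ?_ ?_
  · intro i j
    fin_cases i <;> fin_cases j <;>
      simp [hab.ne, hab.ne', hbc.ne, hbc.ne', hne, hne.symm, hva, hvb, hvc, hva.symm, hvb.symm,
        hvc.symm]
  · intro i j
    fin_cases i <;> fin_cases j <;>
      simp [copawGraph, pawGraph, hab, hab.symm, hbc, hbc.symm, hac, h1, h2, h3, G.adj_comm a v,
        G.adj_comm b v, G.adj_comm c v, G.adj_comm c a]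

end Families

/-- Either every other vertex is adjacent to both `a` and `c`, which gives the complement of a
matching, or `b` has no neighbors besides `a` and `c`. In the latter case at most one further vertex
is attached to each of `a` and `c`, leaving only $P_4$ and $C_5$. -/
theorem structure_of_adj_conditions {V : Type u} (G : SimpleGraph V)
    (H1 : ∀ a x y z, G.Adj a x → G.Adj a y → G.Adj a z → x ≠ y → x ≠ z → y ≠ z →
      G.Adj x y ∨ G.Adj x z)
    (H2 : ∀ a b c v, G.Adj a b → G.Adj b c → ¬ G.Adj a c → a ≠ c → v ≠ a → v ≠ b → v ≠ c →
      G.Adj v a ∨ G.Adj v b ∨ G.Adj v c)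
    {a b c : V} (hab : G.Adj a b) (hbc : G.Adj b c) (hac : ¬ G.Adj a c) (hne : a ≠ c) :
    (∀ x y z, x ≠ y → x ≠ z → y ≠ z → G.Adj x y ∨ G.Adj x z) ∨
    (∃ a b c v, G.Adj a b ∧ G.Adj b c ∧ ¬ G.Adj a c ∧ a ≠ c ∧ G.Adj v a ∧ ¬ G.Adj v b ∧
      ¬ G.Adj v c ∧ v ≠ b ∧ v ≠ c ∧ ∀ w, w = a ∨ w = b ∨ w = c ∨ w = v) ∨
    (∃ v w, G.Adj v a ∧ ¬ G.Adj v b ∧ ¬ G.Adj v c ∧ ¬ G.Adj w a ∧ ¬ G.Adj w b ∧ G.Adj w c ∧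
      G.Adj v w ∧ v ≠ b ∧ v ≠ c ∧ w ≠ a ∧ w ≠ b ∧
      ∀ x, x = a ∨ x = b ∨ x = c ∨ x = v ∨ x = w) := by
  have sym := G.adj_comm
  have irr : ∀ x, ¬ G.Adj x x := fun x => G.irrefl
  -- neighbors of `b` are adjacent to both `a` and `c`
  have hb : ∀ v, v ≠ a → v ≠ c → G.Adj b v → G.Adj v a ∧ G.Adj v c := by
    intro v hva hvc hbv
    have h1 := H1 b a v c hab.symm hbv hbc hva.symm hne hvc
    have h2 := H1 b c v a hbc hbv hab.symm hvc.symm hne.symm hva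
    grind
  have hcov : ∀ v, v ≠ a → v ≠ b → v ≠ c → G.Adj v a ∨ G.Adj v c := by
    intro v hva hvb hvc
    have := H2 a b c v hab hbc hac hne hva hvb hvc
    have := hb v hva hvc
    grind
  -- `a` has at most one neighbor that is neither `b` nor a neighbor of `b`
  have ha1 : ∀ v w, G.Adj a v → G.Adj a w → ¬ G.Adj b v → ¬ G.Adj b w → v ≠ b → w ≠ b → v = w := by
    intro v w h1 h2 h3 h4 h5 h6
    by_contra hvw
    exact (H1 a b v w hab h1 h2 h5.symm h6.symm hvw).elim h3 h4
  have hc1 : ∀ v w, G.Adj c v → G.Adj c w → ¬ G.Adj b v → ¬ G.Adj b w → v ≠ b → w ≠ b → v = w := by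
    intro v w h1 h2 h3 h4 h5 h6
    by_contra hvw
    exact (H1 c b v w hbc.symm h1 h2 h5.symm h6.symm hvw).elim h3 h4
  by_cases hA : ∀ v, v ≠ a → v ≠ b → v ≠ c → G.Adj v a ∧ G.Adj v c
  · left
    -- Thus `a` and `c` are each other's only non-neighbors, and all remaining vertices are
    -- neighbors of `a`, where `H1` applies.
    have hA' : ∀ v, v = a ∨ v = c ∨ (G.Adj v a ∧ G.Adj v c) := by grind
    intro x y z hxy hxz hyz
    have hxyz := H1 a x y z
    rcases hA' x with rfl | rfl | hx <;> rcases hA' y with rfl | rfl | hy <;>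
      rcases hA' z with rfl | rfl | hz <;> clear H1 H2 hA hA' hb hcov ha1 hc1 <;> grind
  right
  -- Suppose `f` is another neighbor of `b`, hence adjacent to `a` and `c`. A vertex `v` not
  -- adjacent to `b` but adjacent to `a`, say, must be adjacent to `f` by `H1` at `a`, and then to
  -- `c` by `H1` at `f`. This would contradict the failure of `hA`.
  have hF : ∀ f, f ≠ a → f ≠ c → ¬ G.Adj b f := by
    intro f hfa hfc hbf
    refine hA fun v hva hvb hvc => ?_
    obtain ⟨h1, h2⟩ := hb f hfa hfc hbf
    by_cases hbv : G.Adj b v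
    · exact hb v hva hvc hbv
    have hfb : f ≠ b := hbf.ne'
    have hfv : v ≠ f := fun h => hbv (h ▸ hbf)
    rcases hcov v hva hvb hvc with h | h
    · have h3 := H1 a v b f h.symm hab h1.symm hvb hfv hfb.symm
      have h4 := H1 f c a v h2 h1
      grind
    · have h3 := H1 c v b f h.symm hbc.symm h2.symm hvb hfv hfb.symm
      have h4 := H1 f a c v h1 h2
      grind
  by_cases hv : ∃ v, v ≠ b ∧ v ≠ c ∧ G.Adj v a ∧ ¬ G.Adj v c
  · obtain ⟨v, hvb, hvc, hva, hvc'⟩ := hv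
    have hbv := hF v hva.ne hvc
    by_cases hw : ∃ w, w ≠ b ∧ w ≠ a ∧ G.Adj w c ∧ ¬ G.Adj w a
    · obtain ⟨w, hwb, hwa, hwc, hwa'⟩ := hw
      have hbw := hF w hwa hwc.ne
      right
      -- The induced path `v, a, b` must have a neighbor of `w` on it, and only `v` is possible:
      -- this edge closes the five-cycle.
      have hvw := H2 v a b w hva hab
      refine ⟨v, w, hva, ?_, hvc', hwa', ?_, hwc, ?_, hvb, hvc, hwa, hwb, fun x => ?_⟩
      · grind
      · grind
      · grind
      · have := ha1 x v
        have := hc1 x w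
        have := hF x
        have := hcov x
        grind
    · left
      refine ⟨a, b, c, v, hab, hbc, hac, hne, hva, by grind, hvc', hvb, hvc, fun x => ?_⟩
      have := ha1 x v
      have := hF x
      have := hcov x
      grind
  · left
    -- The mirror image: the extra vertex is attached to `c` only, so the path is read from `c` to
    -- `a`.
    obtain ⟨w, hwa, hwb, hwc, hw⟩ : ∃ w, w ≠ a ∧ w ≠ b ∧ w ≠ c ∧ ¬ (G.Adj w a ∧ G.Adj w c) := by
      push Not at hA
      obtain ⟨w, h1, h2, h3, h4⟩ := hA
      exact ⟨w, h1, h2, h3, fun h => h4 h.1 h.2⟩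
    have hbw := hF w hwa hwc
    have := hcov w hwa hwb hwc
    have hw1 : G.Adj w c ∧ ¬ G.Adj w a := by grind
    refine ⟨c, b, a, w, hbc.symm, hab.symm, by grind, hne.symm, hw1.1, by grind, hw1.2, hwb, hwa,
      fun x => ?_⟩
    have := hc1 x w
    have := hF x
    have := hcov x
    grind

theorem isEPositive_of_labelling {V : Type*} [Fintype V] {n : ℕ} {H : SimpleGraph (Fin n)}
    (hH : IsEPositive (chromaticSymmetricFunction H)) (G : SimpleGraph V) (f : Fin n → V)
    (hf : ∀ i j, f i = f j → i = j) (hs : ∀ v, ∃ i, f i = v)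
    (h : ∀ i j, G.Adj (f i) (f j) ↔ H.Adj i j) :
    IsEPositive (chromaticSymmetricFunction G) := by
  let e : H ≃g G := ⟨Equiv.ofBijective f ⟨fun i j => hf i j, hs⟩, fun {i j} => h i j⟩
  rwa [← chromaticSymmetricFunction_congr e]

theorem mainTheorem5 {V : Type*} [Fintype V] (G : SimpleGraph V)
    (hclaw : IsInducedFree clawGraph G) (hpaw : IsInducedFree pawGraph G)
    (hcopaw : IsInducedFree copawGraph G) :
    IsEPositive (chromaticSymmetricFunction G) := by
  by_cases hG : ∀ a b c, G.Adj a b → G.Adj b c → a ≠ c → G.Adj a c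
  · exact isEPositive_of_cluster G hG
  push Not at hG
  obtain ⟨a, b, c, hab, hbc, hne, hac⟩ := hG
  have sym := G.adj_comm
  rcases structure_of_adj_conditions G
    (fun _ _ _ _ => adj_or_adj_of_claw_paw_free hclaw hpaw)
    (fun _ _ _ _ => adj_of_copaw_free hcopaw) hab hbc hac hne with
    h | ⟨a, b, c, v, hab, hbc, hac, hne, hva, hvb, hvc, hvb', hvc', hall⟩ |
    ⟨v, w, hva, hvb, hvc, hwa, hwb, hwc, hvw, hvb', hvc', hwa', hwb', hall⟩
  · exact IsCoMatching.isEPositive h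
  · refine isEPositive_of_labelling isEPositive_pathFour G ![v, a, b, c] ?_ ?_ ?_
    · have := hab.ne
      have := hbc.ne
      have := hva.ne
      intro i j
      fin_cases i <;> fin_cases j <;> simp <;> grind
    · intro x
      rcases hall x with rfl | rfl | rfl | rfl
      exacts [⟨1, rfl⟩, ⟨2, rfl⟩, ⟨3, rfl⟩, ⟨0, rfl⟩]
    · intro i j
      fin_cases i <;> fin_cases j <;> simp <;> grind
  · refine isEPositive_of_labelling isEPositive_cycleGraph_five G ![v, a, b, c, w] ?_ ?_ ?_
    · have := hab.ne
      have := hbc.ne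
      have := hva.ne
      have := hwc.ne
      have := hvw.ne
      intro i j
      fin_cases i <;> fin_cases j <;> simp <;> grind
    · intro x
      rcases hall x with rfl | rfl | rfl | rfl | rfl
      exacts [⟨1, rfl⟩, ⟨2, rfl⟩, ⟨3, rfl⟩, ⟨0, rfl⟩, ⟨4, rfl⟩]
    · intro i j
      fin_cases i <;> fin_cases j <;> simp [SimpleGraph.cycleGraph_adj] <;> grind
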